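/- Let $q\in\mathbb C$ with $|q|<1$. Write $(x;q)_n=\prod_{k=0}^{n-1}(1-xq^k)$ for $0\le n\le\infty$ and $(x_1,\dots,x_m;q)_n=\prod_{i}(x_i;q)_n$. Put $\Delta(u,v)=v\,(q,u/v,qv/u;q)_\infty$, $${}_3\phi_2\left({a_1,a_2,a_3\atop b_1,b_2};q,z\right)=\sum_{n=0}^\infty\frac{(a_1,a_2,a_3;q)_n}{(q,b_1,b_2;q)_n}z^n,$$ $$\int_u^v f(x)\,d_qx=(1-q)\sum_{n=0}^\infty\bigl[v f(vq^n)-u f(uq^n)\bigr]q^n .$$ Let $a,b,c,d,u,v$ be complex numbers with $uv\ne0$ and $$\max\{|au|,|bu|,|cu|,|av|,|bv|,|cv|\}<1 .$$ Assume further that $|bduv|<1$ and that, for every integer $n\ge0$, none of $duq^n$, $dvq^n$, $acdu^2vq^n$, $acduv^2q^n$ equals $1$ (all these further conditions hold, for instance, if $|du|<1$ and $|dv|<1$). Then the ${}_3\phi_2$ series below converges absolutely at every point $x=uq^n$ and $x=vq^n$, $n\ge 0$, the series defining the $q$-integral below converges absolutely, and $$\int_u^v\frac{(qx/u,\,qx/v,\,abcuvx,\,acduvx;q)_\infty}{(ax,bx,cx,dx;q)_\infty}\;{}_3\phi_2\left({acuv,\,ax,\,cx\atop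 abcuvx,\,acduvx};q,\,bduv\right)d_qx$$ $$=\frac{(1-q)\,\Delta(u,v)\,(abuv,acuv,aduv,bcuv,cduv;q)_\infty}{(au,av,bu,bv,cu,cv,du,dv;q)_\infty}.$$ -/

import Mathlib

noncomputable section

namespace QSeries

/-- The finite `q`-shifted factorial `(a; q)_n = ∏_{k=0}^{n-1} (1 - a q^k)`. -/
def qPoch (a q : ℂ) (n : ℕ) : ℂ := ∏ k ∈ Finset.range n, (1 - a * q ^ k)

/-- The infinite `q`-shifted factorial `(a; q)_∞ = ∏_{k=0}^∞ (1 - a q^k)`, used for `|q| < 1`. -/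
def qPochInf (a q : ℂ) : ℂ := ∏' k : ℕ, (1 - a * q ^ k)

/-- The infinite product defining `(a; q)_∞` converges when `|q| < 1`. -/
theorem multipliable_qPochInf (a : ℂ) {q : ℂ} (hq : ‖q‖ < 1) :
    Multipliable fun k : ℕ => 1 - a * q ^ k := by
  have h : Summable fun k : ℕ => ‖-(a * q ^ k)‖ := by
    simpa only [norm_neg, norm_mul, norm_pow] using
      (summable_geometric_of_lt_one (norm_nonneg q) hq).mul_left ‖a‖
  simpa only [sub_eq_add_neg] using multipliable_one_add_of_summable h

/-- The multiple factorial `(a₁, …, a_m; q)_n = (a₁; q)_n ⋯ (a_m; q)_n`. -/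
def qPochs (as : List ℂ) (q : ℂ) (n : ℕ) : ℂ := (as.map fun a => qPoch a q n).prod

/-- The multiple factorial `(a₁, …, a_m; q)_∞ = (a₁; q)_∞ ⋯ (a_m; q)_∞`. -/
def qPochsInf (as : List ℂ) (q : ℂ) : ℂ := (as.map fun a => qPochInf a q).prod

/-- The `n`-th term of the basic hypergeometric series `_rφ_s(as; bs; q, z)`, where `r` and `s`
are the numbers of upper and lower parameters:
`(a₁, …, a_r; q)_n / (q, b₁, …, b_s; q)_n * ((-1)^n q^{n(n-1)/2})^{1+s-r} z^n`. -/
def phiTerm (as bs : List ℂ) (q z : ℂ) (n : ℕ) : ℂ :=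
  qPochs as q n / qPochs (q :: bs) q n
    * ((-1) ^ n * q ^ (n * (n - 1) / 2)) ^ (1 + (bs.length : ℤ) - (as.length : ℤ)) * z ^ n

/-- The basic hypergeometric series `_rφ_s(as; bs; q, z)`. -/
def phi (as bs : List ℂ) (q z : ℂ) : ℂ := ∑' n : ℕ, phiTerm as bs q z n

/-- The theta function `Δ(u, v) = v (q, u/v, qv/u; q)_∞`. -/
def thetaDelta (q u v : ℂ) : ℂ := v * qPochsInf [q, u / v, q * v / u] q

/-- The series defining the Thomae–Jackson `q`-integral of `f` from `a` to `b` converges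
(absolutely). -/
def QIntegrable (q a b : ℂ) (f : ℂ → ℂ) : Prop :=
  Summable fun n : ℕ => (b * f (b * q ^ n) - a * f (a * q ^ n)) * q ^ n

/-- The Thomae–Jackson `q`-integral
`∫_a^b f(x) d_q x = (1 - q) ∑_{n ≥ 0} (b f(b q^n) - a f(a q^n)) q^n`. -/
def qIntegral (q a b : ℂ) (f : ℂ → ℂ) : ℂ :=
  (1 - q) * ∑' n : ℕ, (b * f (b * q ^ n) - a * f (a * q ^ n)) * q ^ n

/-- The `q`-integral of `f` from `a` to `b` converges and has the value `I`. -/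
def HasQIntegral (q a b : ℂ) (f : ℂ → ℂ) (I : ℂ) : Prop :=
  QIntegrable q a b f ∧ qIntegral q a b f = I

end QSeries

end

namespace QSeries

open Filter Topology

/-! Write I(a,b,c,d) for the integral. The parameters are sent to zero one at a time by a
first-order q-difference equation in b. A contiguous relation for the ₃φ₂ (`phi_contiguous`) makes a
combination of the integrands for b and bq an exact q-difference in x (`integrand_step`). The
boundary function vanishes at x = u and x = v, and its limits along uqⁿ and vqⁿ agree, so the
boundary contributions of the two halves cancel: (1 - bu)(1 - bv) I(b) = (1 - abuv)(1 - bcuv) I(bq).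
Iterating, with bqⁿ → 0 under dominated convergence, gives (bu, bv; q)_∞ I(b) = (abuv, bcuv; q)_∞
I(0) (`integralSum_eq`). At b = 0 the series reduces to 1 and d can take the place of b. The same
equation therefore removes d, then c, then a, and the successive factors make up the stated product.
What remains is I(0,0,0,0) = Δ(u,v), up to the factor 1 - q. The equation is run backwards from b =
q/u: there (qx/u; q)_∞ cancels and the integral telescopes. -/

/-! ### q-shifted factorials: recurrences, limits, uniform bounds -/

theorem qPoch_succ (a q : ℂ) (n : ℕ) : qPoch a q (n + 1) = qPoch a q n * (1 - a * q ^ n) :=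
  Finset.prod_range_succ _ _

theorem qPoch_succ' (a q : ℂ) (n : ℕ) : qPoch a q (n + 1) = (1 - a) * qPoch (a * q) q n := by
  simp only [qPoch, Finset.prod_range_succ', pow_zero, mul_one]
  rw [mul_comm]
  congr 1
  exact Finset.prod_congr rfl fun k _ => by ring

theorem qPoch_add (a q : ℂ) (m n : ℕ) :
    qPoch a q (m + n) = qPoch a q m * qPoch (a * q ^ m) q n := by
  simp only [qPoch, Finset.prod_range_add, pow_add, mul_assoc]

@[simp] theorem qPoch_zero_right (a q : ℂ) : qPoch a q 0 = 1 := by simp [qPoch]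

@[simp] theorem qPoch_zero_left (q : ℂ) (n : ℕ) : qPoch 0 q n = 1 := by simp [qPoch]

@[simp] theorem qPochInf_zero_left (q : ℂ) : qPochInf 0 q = 1 := by simp [qPochInf]

theorem qPoch_ne_zero {a q : ℂ} (h : ∀ n : ℕ, a * q ^ n ≠ 1) (n : ℕ) : qPoch a q n ≠ 0 :=
  Finset.prod_ne_zero_iff.2 fun k _ => sub_ne_zero.2 (h k).symm

theorem continuous_qPoch (q : ℂ) (n : ℕ) : Continuous fun a => qPoch a q n := by
  unfold qPoch
  fun_prop

theorem summable_norm_mul_pow (a : ℂ) {q : ℂ} (hq : ‖q‖ < 1) :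
    Summable fun k : ℕ => ‖-(a * q ^ k)‖ := by
  simpa only [norm_neg, norm_mul, norm_pow] using
    (summable_geometric_of_lt_one (norm_nonneg q) hq).mul_left ‖a‖

theorem qPochInf_eq_mul (a : ℂ) {q : ℂ} (hq : ‖q‖ < 1) :
    qPochInf a q = (1 - a) * qPochInf (a * q) q := by
  have e : (fun k : ℕ => 1 - a * q ^ (k + 1)) = fun k : ℕ => 1 - a * q * q ^ k := by
    funext k
    rw [pow_succ', mul_assoc]
  have h := multipliable_qPochInf (a * q) hq
  rw [← e] at h
  rw [qPochInf, qPochInf, tprod_eq_zero_mul' (f := fun k : ℕ => 1 - a * q ^ k) h, e, pow_zero,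
    mul_one]

theorem qPochInf_ne_zero {a q : ℂ} (hq : ‖q‖ < 1) (h : ∀ n : ℕ, a * q ^ n ≠ 1) :
    qPochInf a q ≠ 0 := by
  have := tprod_one_add_ne_zero_of_summable (f := fun k : ℕ => -(a * q ^ k))
    (fun k => by
      rw [← sub_eq_add_neg]
      exact sub_ne_zero.2 (h k).symm) (summable_norm_mul_pow a hq)
  simpa only [qPochInf, sub_eq_add_neg] using this

theorem qPochInf_one {q : ℂ} (hq : ‖q‖ < 1) : qPochInf 1 q = 0 := by
  rw [qPochInf_eq_mul 1 hq, sub_self, zero_mul]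

theorem tendsto_qPoch (a : ℂ) {q : ℂ} (hq : ‖q‖ < 1) :
    Tendsto (qPoch a q) atTop (𝓝 (qPochInf a q)) :=
  (multipliable_qPochInf a hq).tendsto_prod_tprod_nat

theorem tendsto_mul_pow (a : ℂ) {q : ℂ} (hq : ‖q‖ < 1) :
    Tendsto (fun n : ℕ => a * q ^ n) atTop (𝓝 0) := by
  simpa using (tendsto_pow_atTop_nhds_zero_of_norm_lt_one hq).const_mul a

theorem tendsto_qPochInf_mul_pow (a : ℂ) {q : ℂ} (hq : ‖q‖ < 1) :
    Tendsto (fun n : ℕ => qPochInf (a * q ^ n) q) atTop (𝓝 1) := by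
  have h := tendsto_tprod_one_add_of_dominated_convergence (𝓕 := (atTop : Filter ℕ))
    (f := fun n k : ℕ => -(a * q ^ n * q ^ k)) (g := fun _ => 0)
    (bound := fun k => ‖-(a * q ^ k)‖) (summable_norm_mul_pow a hq)
    (fun k => by
      have := ((tendsto_mul_pow a hq).mul_const (q ^ k)).neg
      simpa using this)
    (Eventually.of_forall fun n k => by
      rw [norm_neg, norm_neg, mul_right_comm, norm_mul _ (q ^ n), norm_pow q n]
      exact mul_le_of_le_one_right (norm_nonneg _) (pow_le_one₀ (norm_nonneg _) hq.le))
  simpa only [qPochInf, sub_eq_add_neg, add_zero, tprod_one] using h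

theorem exists_norm_le_of_tendsto {f : ℕ → ℂ} {l : ℂ} (h : Tendsto f atTop (𝓝 l)) :
    ∃ M, ∀ n, ‖f n‖ ≤ M := by
  obtain ⟨M, hM⟩ := h.norm.bddAbove_range
  exact ⟨M, fun n => hM ⟨n, rfl⟩⟩

/-- Uniformity in both the shift and the length is what later allows dominated convergence in b and
in x. -/
theorem exists_norm_qPoch_mul_pow_le (a : ℂ) {q : ℂ} (hq : ‖q‖ < 1) :
    ∃ M, ∀ n k : ℕ, ‖qPoch (a * q ^ n) q k‖ ≤ M := by
  refine ⟨Real.exp (∑' k : ℕ, ‖-(a * q ^ k)‖), fun n k => ?_⟩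
  calc ‖qPoch (a * q ^ n) q k‖ ≤ ∏ j ∈ Finset.range k, (1 + ‖-(a * q ^ j)‖) := by
        rw [qPoch, norm_prod]
        refine Finset.prod_le_prod (fun _ _ => norm_nonneg _) fun j _ => ?_
        refine (norm_sub_le _ _).trans ?_
        rw [norm_one, norm_neg, mul_right_comm, norm_mul _ (q ^ n), norm_pow q n]
        gcongr
        exact mul_le_of_le_one_right (norm_nonneg _) (pow_le_one₀ (norm_nonneg _) hq.le)
    _ ≤ Real.exp (∑ j ∈ Finset.range k, ‖-(a * q ^ j)‖) :=
        Real.prod_one_add_le_exp_sum _ fun _ => norm_nonneg _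
    _ ≤ _ := Real.exp_le_exp.2
        ((summable_norm_mul_pow a hq).sum_le_tsum _ fun _ _ => norm_nonneg _)

/-- Since (aqⁿ; q)_k = (a; q)_{n+k} / (a; q)_n, bounds on two convergent sequences suffice. -/
theorem exists_norm_inv_qPoch_mul_pow_le {a q : ℂ} (hq : ‖q‖ < 1)
    (h : ∀ n : ℕ, a * q ^ n ≠ 1) : ∃ M, ∀ n k : ℕ, ‖(qPoch (a * q ^ n) q k)⁻¹‖ ≤ M := by
  obtain ⟨M, hM⟩ := exists_norm_le_of_tendsto
    ((tendsto_qPoch a hq).inv₀ (qPochInf_ne_zero hq h))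
  obtain ⟨N, hN⟩ := exists_norm_le_of_tendsto (tendsto_qPoch a hq)
  refine ⟨N * M, fun n k => ?_⟩
  have e : (qPoch (a * q ^ n) q k)⁻¹ = qPoch a q n * (qPoch a q (n + k))⁻¹ := by
    rw [qPoch_add, mul_inv, mul_inv_cancel_left₀ (qPoch_ne_zero h n)]
  rw [e, norm_mul]
  exact mul_le_mul (hN n) (hM _) (norm_nonneg _) ((norm_nonneg _).trans (hN n))

/-! ### Convergence of the ₃φ₂ -/

theorem phiTerm_three_two (a₁ a₂ a₃ b₁ b₂ q z : ℂ) (n : ℕ) :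
    phiTerm [a₁, a₂, a₃] [b₁, b₂] q z n =
      qPoch a₁ q n * qPoch a₂ q n * qPoch a₃ q n * (qPoch q q n)⁻¹ * (qPoch b₁ q n)⁻¹
        * (qPoch b₂ q n)⁻¹ * z ^ n := by
  simp only [phiTerm, qPochs, List.map_cons, List.map_nil, List.prod_cons, List.prod_nil,
    List.length_cons, List.length_nil]
  have e : 1 + ((0 + 1 + 1 : ℕ) : ℤ) - ((0 + 1 + 1 + 1 : ℕ) : ℤ) = 0 := by norm_num
  rw [e, zpow_zero]
  simp only [div_eq_mul_inv, mul_inv]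
  ring

theorem mul_pow_self_ne_one {q : ℂ} (hq : ‖q‖ < 1) (n : ℕ) : q * q ^ n ≠ 1 := by
  intro h
  have := congrArg norm h
  rw [← pow_succ', norm_pow, norm_one] at this
  exact (pow_lt_one₀ (norm_nonneg _) hq n.succ_ne_zero).ne this

theorem mul_pow_ne_one {a q : ℂ} (hq : ‖q‖ < 1) (ha : ‖a‖ < 1) (n : ℕ) : a * q ^ n ≠ 1 := by
  intro h
  have := congrArg norm h
  rw [norm_mul, norm_pow, norm_one] at this
  exact (mul_lt_one_of_nonneg_of_lt_one_left (norm_nonneg _) ha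
    (pow_le_one₀ (norm_nonneg _) hq.le)).ne this

/-- The terms of a `₃φ₂` are bounded geometrically, uniformly under `q`-shifts. -/
theorem exists_norm_phiTerm_le {q : ℂ} (hq : ‖q‖ < 1) (a₁ a₂ a₃ : ℂ) {b₁ b₂ : ℂ}
    (h₁ : ∀ n : ℕ, b₁ * q ^ n ≠ 1) (h₂ : ∀ n : ℕ, b₂ * q ^ n ≠ 1) :
    ∃ M, 0 ≤ M ∧ ∀ (z : ℂ) (m n k : ℕ),
      ‖phiTerm [a₁, a₂ * q ^ n, a₃ * q ^ n] [b₁ * q ^ m, b₂ * q ^ n] q z k‖ ≤ M * ‖z‖ ^ k := by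
  obtain ⟨A₁, hA₁⟩ := exists_norm_qPoch_mul_pow_le a₁ hq
  obtain ⟨A₂, hA₂⟩ := exists_norm_qPoch_mul_pow_le a₂ hq
  obtain ⟨A₃, hA₃⟩ := exists_norm_qPoch_mul_pow_le a₃ hq
  obtain ⟨Q, hQ⟩ := exists_norm_inv_qPoch_mul_pow_le hq (mul_pow_self_ne_one hq)
  obtain ⟨B₁, hB₁⟩ := exists_norm_inv_qPoch_mul_pow_le hq h₁
  obtain ⟨B₂, hB₂⟩ := exists_norm_inv_qPoch_mul_pow_le hq h₂
  have p₁ := (norm_nonneg _).trans (hA₁ 0 0)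
  have p₂ := (norm_nonneg _).trans (hA₂ 0 0)
  have p₃ := (norm_nonneg _).trans (hA₃ 0 0)
  have pQ := (norm_nonneg _).trans (hQ 0 0)
  have r₁ := (norm_nonneg _).trans (hB₁ 0 0)
  have r₂ := (norm_nonneg _).trans (hB₂ 0 0)
  refine ⟨A₁ * A₂ * A₃ * Q * B₁ * B₂, by positivity, fun z m n k => ?_⟩
  have e₁ := hA₁ 0 k
  have eQ := hQ 0 k
  rw [pow_zero, mul_one] at e₁ eQ
  rw [phiTerm_three_two]
  simp only [norm_mul, norm_pow z]
  gcongr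
  exacts [hA₂ n k, hA₃ n k, hB₁ m k, hB₂ n k]

theorem summable_phiTerm {q : ℂ} (hq : ‖q‖ < 1) (a₁ a₂ a₃ : ℂ) {b₁ b₂ z : ℂ}
    (h₁ : ∀ n : ℕ, b₁ * q ^ n ≠ 1) (h₂ : ∀ n : ℕ, b₂ * q ^ n ≠ 1) (hz : ‖z‖ < 1) :
    Summable (phiTerm [a₁, a₂, a₃] [b₁, b₂] q z) := by
  obtain ⟨M, -, hM⟩ := exists_norm_phiTerm_le hq a₁ a₂ a₃ h₁ h₂
  refine Summable.of_norm_bounded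
    ((summable_geometric_of_lt_one (norm_nonneg z) hz).mul_left M) fun k => ?_
  simpa using hM z 0 0 k

/-! ### Contiguous relation and limits of the ₃φ₂ -/

/-- A contiguous relation for the `₃φ₂` whose argument is the quotient of the products of its
lower and upper parameters. -/
theorem phi_contiguous {q : ℂ} (hq : ‖q‖ < 1) (a b c d t x : ℂ)
    (hB : ∀ n : ℕ, a * b * c * t * x * q ^ n ≠ 1) (hL : ∀ n : ℕ, a * c * d * t * x * q ^ n ≠ 1)
    (hz : ‖b * d * t‖ < 1) :
    (x - t * b) * (1 - a * b * c * t * x) * (1 - a * c * d * t * x)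
        * phi [a * c * t, a * x, c * x] [a * b * c * t * x, a * c * d * t * x] q (b * d * t)
      = x * (1 - a * c * d * t * x) * (1 - a * b * t) * (1 - b * c * t)
          * phi [a * c * t, a * x, c * x] [a * b * c * t * x * q, a * c * d * t * x] q
            (b * d * t * q)
        - t * b * (1 - a * x) * (1 - c * x) * (1 - d * x)
          * phi [a * c * t, a * x * q, c * x * q]
            [a * b * c * t * x * q, a * c * d * t * x * q] q (b * d * t) := by
  have shift {y : ℂ} (h : ∀ n : ℕ, y * q ^ n ≠ 1) (n : ℕ) : y * q * q ^ n ≠ 1 := by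
    rw [mul_assoc, ← pow_succ']
    exact h _
  have hzq : ‖b * d * t * q‖ < 1 := by
    rw [norm_mul]
    exact mul_lt_one_of_nonneg_of_lt_one_left (norm_nonneg _) hz hq.le
  generalize hBdef : a * b * c * t * x = B at *
  generalize hLdef : a * c * d * t * x = L at *
  have s₀ := summable_phiTerm hq (a * c * t) (a * x) (c * x) hB hL hz
  have s₁ := summable_phiTerm hq (a * c * t) (a * x) (c * x) (shift hB) hL hzq
  have s₂ := summable_phiTerm hq (a * c * t) (a * x * q) (c * x * q) (shift hB) (shift hL) hz
  set T₀ := phiTerm [a * c * t, a * x, c * x] [B, L] q (b * d * t) with hT₀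
  set T₁ := phiTerm [a * c * t, a * x, c * x] [B * q, L] q (b * d * t * q) with hT₁
  set T₂ := phiTerm [a * c * t, a * x * q, c * x * q] [B * q, L * q] q (b * d * t) with hT₂
  -- The relation holds termwise up to the difference of consecutive values of (1 - q^k) T₀ k.
  have key (k : ℕ) : (x - t * b) * (1 - B) * (1 - L) * T₀ k
      - x * (1 - L) * (1 - a * b * t) * (1 - b * c * t) * T₁ k
      + t * b * (1 - a * x) * (1 - c * x) * (1 - d * x) * T₂ k
      = x * (1 - B) * (1 - L) * ((1 - q ^ k) * T₀ k - (1 - q ^ (k + 1)) * T₀ (k + 1)) := by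
    have hBk : 1 - B * q ^ k ≠ 0 := sub_ne_zero.2 (hB k).symm
    have hLk : 1 - L * q ^ k ≠ 0 := sub_ne_zero.2 (hL k).symm
    have hB0 : 1 - B ≠ 0 := sub_ne_zero.2 fun e => hB 0 (by simp [← e])
    have hL0 : 1 - L ≠ 0 := sub_ne_zero.2 fun e => hL 0 (by simp [← e])
    have hqk : 1 - q * q ^ k ≠ 0 := sub_ne_zero.2 (mul_pow_self_ne_one hq k).symm
    have nB := qPoch_ne_zero hB k
    have nL := qPoch_ne_zero hL k
    have nBq := qPoch_ne_zero (shift hB) k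
    have nLq := qPoch_ne_zero (shift hL) k
    have nq := qPoch_ne_zero (mul_pow_self_ne_one hq) k
    have sh (y : ℂ) : (1 - y) * qPoch (y * q) q k = qPoch y q k * (1 - y * q ^ k) := by
      rw [← qPoch_succ', qPoch_succ]
    have iB : (qPoch (B * q) q k)⁻¹ * (1 - B * q ^ k) = (1 - B) * (qPoch B q k)⁻¹ := by
      field_simp
      linear_combination -(sh B)
    have iL : (qPoch (L * q) q k)⁻¹ * (1 - L * q ^ k) = (1 - L) * (qPoch L q k)⁻¹ := by
      field_simp
      linear_combination -(sh L)
    have r₁ : T₁ k * (1 - B * q ^ k) = T₀ k * q ^ k * (1 - B) := by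
      simp only [hT₀, hT₁, phiTerm_three_two, mul_pow _ q]
      linear_combination qPoch (a * c * t) q k * qPoch (a * x) q k * qPoch (c * x) q k
        * (qPoch q q k)⁻¹ * (qPoch L q k)⁻¹ * (b * d * t) ^ k * q ^ k * iB
    have r₂ : (1 - a * x) * (1 - c * x) * T₂ k * ((1 - B * q ^ k) * (1 - L * q ^ k))
        = (1 - a * x * q ^ k) * (1 - c * x * q ^ k) * (1 - B) * (1 - L) * T₀ k := by
      simp only [hT₀, hT₂, phiTerm_three_two]
      calc _ = ((1 - a * x) * qPoch (a * x * q) q k) * ((1 - c * x) * qPoch (c * x * q) q k)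
            * ((qPoch (B * q) q k)⁻¹ * (1 - B * q ^ k))
            * ((qPoch (L * q) q k)⁻¹ * (1 - L * q ^ k))
            * (qPoch (a * c * t) q k * (qPoch q q k)⁻¹ * (b * d * t) ^ k) := by ring
        _ = _ := by
          rw [sh, sh, iB, iL]
          ring
    have r₃ : (1 - q ^ (k + 1)) * T₀ (k + 1) * ((1 - B * q ^ k) * (1 - L * q ^ k))
        = (1 - a * c * t * q ^ k) * (1 - a * x * q ^ k) * (1 - c * x * q ^ k) * (b * d * t)
          * T₀ k := by
      simp only [hT₀, phiTerm_three_two, qPoch_succ, pow_succ', mul_inv]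
      generalize 1 - B * q ^ k = β at *
      generalize 1 - L * q ^ k = γ at *
      generalize 1 - q * q ^ k = δ at *
      field_simp
    -- By `r₁`, `r₂`, `r₃` every term is a rational multiple of `T₀ k`; with denominators cleared, a
    -- polynomial identity in y = q^k remains.
    apply mul_right_cancel₀ (mul_ne_zero hBk hLk)
    generalize T₀ (k + 1) = X at *
    generalize T₀ k = Y at *
    generalize T₁ k = Z at *
    generalize T₂ k = W at *
    rw [pow_succ'] at *
    generalize q ^ k = y at *
    subst hBdef hLdef
    linear_combination -(x * (1 - a * c * d * t * x) * (1 - a * b * t) * (1 - b * c * t)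
      * (1 - a * c * d * t * x * y)) * r₁
      + t * b * (1 - d * x) * r₂
      + x * (1 - a * b * c * t * x) * (1 - a * c * d * t * x) * r₃
  -- The telescoped sum is its initial term, which vanishes because 1 - q^0 = 0.
  have tel : HasSum (fun k : ℕ => (1 - q ^ k) * T₀ k - (1 - q ^ (k + 1)) * T₀ (k + 1)) 0 := by
    have sU : Summable fun k : ℕ => (1 - q ^ k) * T₀ k := by
      refine Summable.of_norm_bounded (s₀.norm.mul_left 2) fun k => ?_
      rw [norm_mul]
      gcongr
      refine (norm_sub_le _ _).trans ?_
      rw [norm_one, norm_pow]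
      linarith [pow_le_one₀ (n := k) (norm_nonneg q) hq.le]
    have h := sU.hasSum.sub ((hasSum_nat_add_iff' 1).2 sU.hasSum)
    simpa using h
  have lhs := ((s₀.hasSum.mul_left ((x - t * b) * (1 - B) * (1 - L))).sub
    (s₁.hasSum.mul_left (x * (1 - L) * (1 - a * b * t) * (1 - b * c * t)))).add
    (s₂.hasSum.mul_left (t * b * (1 - a * x) * (1 - c * x) * (1 - d * x)))
  simp only [key] at lhs
  have := lhs.unique (tel.mul_left _)
  simp only [phi]
  linear_combination this

theorem phi_zero_arg (a₁ a₂ a₃ b₁ b₂ q : ℂ) : phi [a₁, a₂, a₃] [b₁, b₂] q 0 = 1 := by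
  rw [phi, tsum_eq_single 0]
  · simp [phiTerm_three_two]
  · intro k hk
    simp [phiTerm_three_two, hk]

/-- Dominated convergence for the series; nonvanishing denominators are needed only at the limit
parameters. -/
theorem tendsto_phi {q a₁ α₀ β₀ δ₀ ε₀ ζ₀ : ℂ} {α β δ ε ζ : ℕ → ℂ} {M r : ℝ}
    (hα : Tendsto α atTop (𝓝 α₀)) (hβ : Tendsto β atTop (𝓝 β₀)) (hδ : Tendsto δ atTop (𝓝 δ₀))
    (hε : Tendsto ε atTop (𝓝 ε₀)) (hζ : Tendsto ζ atTop (𝓝 ζ₀))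
    (hδ₀ : ∀ k, qPoch δ₀ q k ≠ 0) (hε₀ : ∀ k, qPoch ε₀ q k ≠ 0) (hr₀ : 0 ≤ r) (hr : r < 1)
    (hM : ∀ n k, ‖phiTerm [a₁, α n, β n] [δ n, ε n] q (ζ n) k‖ ≤ M * r ^ k) :
    Tendsto (fun n => phi [a₁, α n, β n] [δ n, ε n] q (ζ n)) atTop
      (𝓝 (phi [a₁, α₀, β₀] [δ₀, ε₀] q ζ₀)) := by
  refine tendsto_tsum_of_dominated_convergence
    ((summable_geometric_of_lt_one hr₀ hr).mul_left M) (fun k => ?_)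
    (Eventually.of_forall fun n k => hM n k)
  have lim {f : ℕ → ℂ} {l : ℂ} (h : Tendsto f atTop (𝓝 l)) :
      Tendsto (fun n => qPoch (f n) q k) atTop (𝓝 (qPoch l q k)) :=
    ((continuous_qPoch q k).tendsto l).comp h
  simp only [phiTerm_three_two]
  exact ((((((lim hα).const_mul _).mul (lim hβ)).mul_const _).mul
    ((lim hδ).inv₀ (hδ₀ k))).mul ((lim hε).inv₀ (hε₀ k))).mul (hζ.pow k)

/-! ### The integrand and its q-difference equation in b -/

/-- None of the denominators of `integrand q a b c d u v x` vanishes at `x` or its `q`-shifts. -/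
structure RegularAt (q a b c d u v x : ℂ) : Prop where
  ha : ∀ n : ℕ, a * x * q ^ n ≠ 1
  hb : ∀ n : ℕ, b * x * q ^ n ≠ 1
  hc : ∀ n : ℕ, c * x * q ^ n ≠ 1
  hd : ∀ n : ℕ, d * x * q ^ n ≠ 1
  hB : ∀ n : ℕ, a * b * c * u * v * x * q ^ n ≠ 1
  hL : ∀ n : ℕ, a * c * d * u * v * x * q ^ n ≠ 1

theorem RegularAt.mul_pow {q a b c d u v x : ℂ} (h : RegularAt q a b c d u v x) (m : ℕ) :
    RegularAt q a b c d u v (x * q ^ m) := by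
  have e (y : ℂ) (n : ℕ) : y * (x * q ^ m) * q ^ n = y * x * q ^ (m + n) := by ring
  constructor <;> intro n <;> rw [e]
  exacts [h.ha _, h.hb _, h.hc _, h.hd _, h.hB _, h.hL _]

theorem RegularAt.mul_pow_right {q a b c d u v x : ℂ} (h : RegularAt q a b c d u v x) (m : ℕ) :
    RegularAt q a (b * q ^ m) c d u v x where
  ha := h.ha
  hb n := by
    have := h.hb (m + n)
    rwa [show b * q ^ m * x * q ^ n = b * x * q ^ (m + n) by ring]
  hc := h.hc
  hd := h.hd
  hB n := by
    have := h.hB (m + n)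
    rwa [show a * (b * q ^ m) * c * u * v * x * q ^ n = a * b * c * u * v * x * q ^ (m + n) by
      ring]
  hL := h.hL

/-- The `₃φ₂` factor of the integrand. -/
noncomputable def phiFactor (q a b c d u v x : ℂ) : ℂ :=
  phi [a * c * u * v, a * x, c * x] [a * b * c * u * v * x, a * c * d * u * v * x] q
    (b * d * u * v)

/-- The integrand, as a function of all its parameters. -/
noncomputable def integrand (q a b c d u v x : ℂ) : ℂ :=
  qPochInf (q * x / u) q * qPochInf (q * x / v) q * qPochInf (a * b * c * u * v * x) q
    * qPochInf (a * c * d * u * v * x) q * (qPochInf (a * x) q)⁻¹ * (qPochInf (b * x) q)⁻¹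
    * (qPochInf (c * x) q)⁻¹ * (qPochInf (d * x) q)⁻¹ * phiFactor q a b c d u v x

/-- The function whose `q`-difference relates the integrands for `b` and `b * q`. -/
noncomputable def boundaryTerm (q a b c d u v x : ℂ) : ℂ :=
  qPochInf (x / u) q * qPochInf (x / v) q * qPochInf (a * b * c * u * v * x) q
    * qPochInf (a * c * d * u * v * x) q * (qPochInf (a * x) q)⁻¹ * (qPochInf (b * x) q)⁻¹
    * (qPochInf (c * x) q)⁻¹ * (qPochInf (d * x) q)⁻¹ * phiFactor q a b c d u v x

theorem qPochInf_inv_eq {z q : ℂ} (hq : ‖q‖ < 1) (h : ∀ n : ℕ, z * q ^ n ≠ 1) :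
    (qPochInf (z * q) q)⁻¹ = (1 - z) * (qPochInf z q)⁻¹ := by
  have hz : 1 - z ≠ 0 := sub_ne_zero.2 fun e => h 0 (by simp [← e])
  rw [qPochInf_eq_mul z hq, mul_inv, mul_inv_cancel_left₀ hz]

theorem integrand_step {q a b c d u v x : ℂ} (hq : ‖q‖ < 1) (hu : u ≠ 0) (hv : v ≠ 0)
    (hz : ‖b * d * u * v‖ < 1) (h : RegularAt q a b c d u v x) :
    (1 - b * u) * (1 - b * v) * (x * integrand q a b c d u v x)
        - (1 - a * b * u * v) * (1 - b * c * u * v) * (x * integrand q a (b * q) c d u v x)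
      = b * u * v * (boundaryTerm q a b c d u v x - boundaryTerm q a b c d u v (x * q)) := by
  have cont := phi_contiguous hq a b c d (u * v) x
    (by simpa only [← mul_assoc] using h.hB) (by simpa only [← mul_assoc] using h.hL)
    (by simpa only [← mul_assoc] using hz)
  simp only [← mul_assoc] at cont
  have e₁ : a * b * q * c * u * v * x = a * b * c * u * v * x * q := by ring
  have e₂ : b * q * x = b * x * q := by ring
  have e₃ : b * q * d * u * v = b * d * u * v * q := by ring
  have e₄ (z : ℂ) : x * q / z = x / z * q := by ring
  have e₅ (z : ℂ) : q * x / z = x / z * q := by ring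
  simp only [integrand, boundaryTerm, phiFactor, e₁, e₂, e₃, e₄, e₅, ← mul_assoc]
  rw [qPochInf_inv_eq hq h.ha, qPochInf_inv_eq hq h.hb, qPochInf_inv_eq hq h.hc,
    qPochInf_inv_eq hq h.hd, qPochInf_eq_mul (x / u) hq, qPochInf_eq_mul (x / v) hq,
    qPochInf_eq_mul (a * b * c * u * v * x) hq, qPochInf_eq_mul (a * c * d * u * v * x) hq]
  generalize phi [a * c * u * v, a * x, c * x]
    [a * b * c * u * v * x, a * c * d * u * v * x] q (b * d * u * v) = φ₀ at *
  generalize phi [a * c * u * v, a * x, c * x]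
    [a * b * c * u * v * x * q, a * c * d * u * v * x] q (b * d * u * v * q) = φ₁ at *
  generalize phi [a * c * u * v, a * x * q, c * x * q]
    [a * b * c * u * v * x * q, a * c * d * u * v * x * q] q (b * d * u * v) = φ₂ at *
  generalize qPochInf (a * b * c * u * v * x * q) q = PB
  generalize qPochInf (a * c * d * u * v * x * q) q = PL
  generalize qPochInf (x / u * q) q = Pu
  generalize qPochInf (x / v * q) q = Pv
  generalize (qPochInf (a * x) q)⁻¹ = Pa
  generalize (qPochInf (b * x) q)⁻¹ = Pb
  generalize (qPochInf (c * x) q)⁻¹ = Pc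
  generalize (qPochInf (d * x) q)⁻¹ = Pd
  have hxu : x / u * u = x := div_mul_cancel₀ x hu
  have hxv : x / v * v = x := div_mul_cancel₀ x hv
  generalize x / u = xu at *
  generalize x / v = xv at *
  -- The φ₀ coefficients match because (x - buv)(1 - bx) + b(u - x)(v - x) = x(1 - bu)(1 - bv).
  have e : b * u * v * ((1 - xu) * (1 - xv)) = b * (u - x) * (v - x) := by
    linear_combination b * v * (-1 + xv) * hxu + b * (x - u) * hxv
  linear_combination PB * PL * Pu * Pv * Pa * Pb * Pc * Pd * (1 - b * x) * cont
    - PB * PL * Pu * Pv * Pa * Pb * Pc * Pd * φ₀ * (1 - a * b * c * u * v * x)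
      * (1 - a * c * d * u * v * x) * e

/-! ### Bounds and limits of the integrand and of the boundary term -/

theorem exists_norm_qPochInf_mul_pow_le (z : ℂ) {q : ℂ} (hq : ‖q‖ < 1) :
    ∃ M, 0 ≤ M ∧ ∀ n : ℕ, ‖qPochInf (z * q ^ n) q‖ ≤ M := by
  obtain ⟨M, hM⟩ := exists_norm_le_of_tendsto (tendsto_qPochInf_mul_pow z hq)
  exact ⟨M, (norm_nonneg _).trans (hM 0), hM⟩

theorem tendsto_inv_qPochInf_mul_pow (z : ℂ) {q : ℂ} (hq : ‖q‖ < 1) :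
    Tendsto (fun n : ℕ => (qPochInf (z * q ^ n) q)⁻¹) atTop (𝓝 1) := by
  simpa using (tendsto_qPochInf_mul_pow z hq).inv₀ one_ne_zero

/-- No nonvanishing hypothesis is needed: the products tend to 1, and a zero product has inverse 0
by convention. -/
theorem exists_norm_inv_qPochInf_mul_pow_le (z : ℂ) {q : ℂ} (hq : ‖q‖ < 1) :
    ∃ M, 0 ≤ M ∧ ∀ n : ℕ, ‖(qPochInf (z * q ^ n) q)⁻¹‖ ≤ M := by
  obtain ⟨M, hM⟩ := exists_norm_le_of_tendsto (tendsto_inv_qPochInf_mul_pow z hq)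
  exact ⟨M, (norm_nonneg _).trans (hM 0), hM⟩

section Shifts

variable {q a b c d u v w : ℂ}

theorem norm_mul_pow_le (z : ℂ) (hq : ‖q‖ < 1) (m : ℕ) : ‖z * q ^ m‖ ≤ ‖z‖ := by
  rw [norm_mul, norm_pow]
  exact mul_le_of_le_one_right (norm_nonneg _) (pow_le_one₀ (norm_nonneg _) hq.le)

theorem exists_norm_phiFactorTerm_le (hq : ‖q‖ < 1) (h : RegularAt q a b c d u v w) :
    ∃ M, 0 ≤ M ∧ ∀ m n k : ℕ,
      ‖phiTerm [a * c * u * v, a * (w * q ^ n), c * (w * q ^ n)]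
        [a * (b * q ^ m) * c * u * v * (w * q ^ n), a * c * d * u * v * (w * q ^ n)] q
        (b * q ^ m * d * u * v) k‖ ≤ M * ‖b * d * u * v‖ ^ k := by
  obtain ⟨M, hM₀, hM⟩ :=
    exists_norm_phiTerm_le hq (a * c * u * v) (a * w) (c * w) h.hB h.hL
  refine ⟨M, hM₀, fun m n k => ?_⟩
  -- The lower parameter abcuvx contains both b and x, so it is shifted by m + n.
  have := hM (b * d * u * v * q ^ m) (m + n) n k
  rw [show a * (b * q ^ m) * c * u * v * (w * q ^ n) = a * b * c * u * v * w * q ^ (m + n) by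
    ring, show b * q ^ m * d * u * v = b * d * u * v * q ^ m by ring]
  simp only [← mul_assoc]
  refine this.trans ?_
  gcongr
  exact norm_mul_pow_le _ hq m

theorem exists_norm_integrand_le (hq : ‖q‖ < 1) (hz : ‖b * d * u * v‖ < 1)
    (h : RegularAt q a b c d u v w) :
    ∃ M, ∀ m n : ℕ, ‖integrand q a (b * q ^ m) c d u v (w * q ^ n)‖ ≤ M := by
  obtain ⟨M, hM₀, hM⟩ := exists_norm_phiFactorTerm_le hq h
  obtain ⟨M₁, p₁, h₁⟩ := exists_norm_qPochInf_mul_pow_le (q * w / u) hq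
  obtain ⟨M₂, p₂, h₂⟩ := exists_norm_qPochInf_mul_pow_le (q * w / v) hq
  obtain ⟨M₃, p₃, h₃⟩ := exists_norm_qPochInf_mul_pow_le (a * b * c * u * v * w) hq
  obtain ⟨M₄, p₄, h₄⟩ := exists_norm_qPochInf_mul_pow_le (a * c * d * u * v * w) hq
  obtain ⟨M₅, p₅, h₅⟩ := exists_norm_inv_qPochInf_mul_pow_le (a * w) hq
  obtain ⟨M₆, p₆, h₆⟩ := exists_norm_inv_qPochInf_mul_pow_le (b * w) hq
  obtain ⟨M₇, p₇, h₇⟩ := exists_norm_inv_qPochInf_mul_pow_le (c * w) hq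
  obtain ⟨M₈, p₈, h₈⟩ := exists_norm_inv_qPochInf_mul_pow_le (d * w) hq
  refine ⟨M₁ * M₂ * M₃ * M₄ * M₅ * M₆ * M₇ * M₈ * (M * (1 - ‖b * d * u * v‖)⁻¹),
    fun m n => ?_⟩
  have hφ : ‖phiFactor q a (b * q ^ m) c d u v (w * q ^ n)‖
      ≤ M * (1 - ‖b * d * u * v‖)⁻¹ :=
    tsum_of_norm_bounded
      ((hasSum_geometric_of_lt_one (norm_nonneg _) hz).mul_left M) (hM m n)
  have k₁ := h₁ n
  have k₂ := h₂ n
  have k₃ := h₃ (m + n)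
  have k₄ := h₄ n
  have k₅ := h₅ n
  have k₆ := h₆ (m + n)
  have k₇ := h₇ n
  have k₈ := h₈ n
  rw [show q * w / u * q ^ n = q * (w * q ^ n) / u by ring] at k₁
  rw [show q * w / v * q ^ n = q * (w * q ^ n) / v by ring] at k₂
  rw [show a * b * c * u * v * w * q ^ (m + n) = a * (b * q ^ m) * c * u * v * (w * q ^ n) by
    ring] at k₃
  rw [show b * w * q ^ (m + n) = b * q ^ m * (w * q ^ n) by ring] at k₆
  rw [mul_assoc _ w] at k₄ k₅ k₇ k₈
  simp only [integrand, norm_mul _ (phiFactor _ _ _ _ _ _ _ _), norm_mul _ (_)⁻¹,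
    norm_mul _ (qPochInf _ _)]
  gcongr

theorem tendsto_integrand (hq : ‖q‖ < 1) (hz : ‖b * d * u * v‖ < 1)
    (h : RegularAt q a b c d u v w) :
    Tendsto (fun m : ℕ => integrand q a (b * q ^ m) c d u v w) atTop
      (𝓝 (integrand q a 0 c d u v w)) := by
  obtain ⟨M, -, hM⟩ := exists_norm_phiFactorTerm_le hq h
  have hφ : Tendsto (fun m : ℕ => phiFactor q a (b * q ^ m) c d u v w) atTop
      (𝓝 (phiFactor q a 0 c d u v w)) := by
    have lim : Tendsto (fun m : ℕ => b * q ^ m) atTop (𝓝 0) := tendsto_mul_pow b hq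
    refine tendsto_phi tendsto_const_nhds tendsto_const_nhds ?_ tendsto_const_nhds ?_ ?_
      (qPoch_ne_zero h.hL) (norm_nonneg _) hz (M := M) fun m k => by simpa using hM m 0 k
    · exact ((((lim.const_mul a).mul_const c).mul_const u).mul_const v).mul_const w
    · exact ((lim.mul_const d).mul_const u).mul_const v
    · simp
  have t₃ := tendsto_qPochInf_mul_pow (a * b * c * u * v * w) hq
  have t₆ := tendsto_inv_qPochInf_mul_pow (b * w) hq
  have e₃ (m : ℕ) : a * b * c * u * v * w * q ^ m = a * (b * q ^ m) * c * u * v * w := by ring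
  have e₆ (m : ℕ) : b * w * q ^ m = b * q ^ m * w := by ring
  simp only [e₃] at t₃
  simp only [e₆] at t₆
  have := ((((((t₃.const_mul (qPochInf (q * w / u) q * qPochInf (q * w / v) q)).mul_const
    (qPochInf (a * c * d * u * v * w) q)).mul_const (qPochInf (a * w) q)⁻¹).mul t₆).mul_const
    (qPochInf (c * w) q)⁻¹).mul_const (qPochInf (d * w) q)⁻¹).mul hφ
  simpa only [integrand, mul_zero, zero_mul, qPochInf_zero_left, inv_one] using this

/-- The limit does not depend on w, so it will cancel between w = u and w = v. -/
theorem tendsto_boundaryTerm (hq : ‖q‖ < 1) (hz : ‖b * d * u * v‖ < 1)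
    (h : RegularAt q a b c d u v w) :
    Tendsto (fun n : ℕ => boundaryTerm q a b c d u v (w * q ^ n)) atTop
      (𝓝 (phi [a * c * u * v, 0, 0] [0, 0] q (b * d * u * v))) := by
  obtain ⟨M, -, hM⟩ := exists_norm_phiFactorTerm_le hq h
  have hφ : Tendsto (fun n : ℕ => phiFactor q a b c d u v (w * q ^ n)) atTop
      (𝓝 (phi [a * c * u * v, 0, 0] [0, 0] q (b * d * u * v))) := by
    have lim (y : ℂ) : Tendsto (fun n : ℕ => y * (w * q ^ n)) atTop (𝓝 0) := by
      simpa using (tendsto_mul_pow w hq).const_mul y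
    refine tendsto_phi (lim _) (lim _) (lim _) (lim _) tendsto_const_nhds ?_ ?_
      (norm_nonneg _) hz (M := M) fun n k => by simpa using hM 0 n k
    · simp
    · simp
  have t (y : ℂ) := tendsto_qPochInf_mul_pow (y * w) hq
  have s (y : ℂ) := tendsto_inv_qPochInf_mul_pow (y * w) hq
  have tu := tendsto_qPochInf_mul_pow (w / u) hq
  have tv := tendsto_qPochInf_mul_pow (w / v) hq
  simp only [mul_assoc _ w] at t s
  simp only [div_mul_eq_mul_div] at tu tv
  have := (((((((tu.mul tv).mul (t (a * b * c * u * v))).mul (t (a * c * d * u * v))).mul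
    (s a)).mul (s b)).mul (s c)).mul (s d)).mul hφ
  simpa only [boundaryTerm, one_mul] using this

theorem summable_integrand (hq : ‖q‖ < 1) (hz : ‖b * d * u * v‖ < 1)
    (h : RegularAt q a b c d u v w) :
    Summable fun n : ℕ => w * integrand q a b c d u v (w * q ^ n) * q ^ n := by
  obtain ⟨M, hM⟩ := exists_norm_integrand_le hq hz h
  refine Summable.of_norm_bounded
    ((summable_geometric_of_lt_one (norm_nonneg q) hq).mul_left (‖w‖ * M)) fun n => ?_
  rw [norm_mul, norm_mul, norm_pow]
  have := hM 0 n
  rw [pow_zero, mul_one] at this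
  gcongr

/-! ### The recursion in b and its limit -/

/-- One half of the series of the `q`-integral of the integrand. -/
noncomputable def halfSum (q a b c d u v w : ℂ) : ℂ :=
  ∑' n : ℕ, w * integrand q a b c d u v (w * q ^ n) * q ^ n

theorem norm_shift_lt_one (hq : ‖q‖ < 1) (hz : ‖b * d * u * v‖ < 1) (m : ℕ) :
    ‖b * q ^ m * d * u * v‖ < 1 := by
  rw [show b * q ^ m * d * u * v = b * d * u * v * q ^ m by ring]
  exact (norm_mul_pow_le _ hq m).trans_lt hz

/-- Sum `integrand_step` along x = wqⁿ. The boundary term at n = 0 contains (1; q)_∞ = 0, so only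
its limit at infinity survives. -/
theorem halfSum_step (hq : ‖q‖ < 1) (hu : u ≠ 0) (hv : v ≠ 0) (hw : w = u ∨ w = v)
    (hz : ‖b * d * u * v‖ < 1) (h : RegularAt q a b c d u v w) :
    (1 - b * u) * (1 - b * v) * halfSum q a b c d u v w
        - (1 - a * b * u * v) * (1 - b * c * u * v) * halfSum q a (b * q) c d u v w
      = -(b * u * v * phi [a * c * u * v, 0, 0] [0, 0] q (b * d * u * v)) := by
  have h' : RegularAt q a (b * q) c d u v w := by simpa using h.mul_pow_right 1
  have hz' : ‖b * q * d * u * v‖ < 1 := by simpa using norm_shift_lt_one hq hz 1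
  have s := ((summable_integrand hq hz h).hasSum.mul_left ((1 - b * u) * (1 - b * v))).sub
    ((summable_integrand hq hz' h').hasSum.mul_left ((1 - a * b * u * v) * (1 - b * c * u * v)))
  have e (n : ℕ) : (1 - b * u) * (1 - b * v) * (w * integrand q a b c d u v (w * q ^ n) * q ^ n)
      - (1 - a * b * u * v) * (1 - b * c * u * v)
        * (w * integrand q a (b * q) c d u v (w * q ^ n) * q ^ n)
      = b * u * v * (boundaryTerm q a b c d u v (w * q ^ n)
        - boundaryTerm q a b c d u v (w * q ^ (n + 1))) := by
    rw [pow_succ, ← mul_assoc w]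
    rw [← integrand_step hq hu hv hz (h.mul_pow n)]
    ring
  simp only [e] at s
  have lim := s.tendsto_sum_nat
  simp only [← Finset.mul_sum, Finset.sum_range_sub'] at lim
  have b0 : boundaryTerm q a b c d u v (w * q ^ 0) = 0 := by
    rcases hw with rfl | rfl
    · simp [boundaryTerm, div_self hu, qPochInf_one hq]
    · simp [boundaryTerm, div_self hv, qPochInf_one hq]
  rw [b0] at lim
  have := tendsto_nhds_unique lim
    (((tendsto_boundaryTerm hq hz h).const_sub 0).const_mul (b * u * v))
  simp only [halfSum]
  rw [this]
  ring

/-- The series of the `q`-integral of the integrand. -/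
noncomputable def integralSum (q a b c d u v : ℂ) : ℂ := halfSum q a b c d u v v - halfSum q a b c d u v u

theorem integralSum_step (hq : ‖q‖ < 1) (hu : u ≠ 0) (hv : v ≠ 0) (hz : ‖b * d * u * v‖ < 1)
    (h₁ : RegularAt q a b c d u v u) (h₂ : RegularAt q a b c d u v v) :
    (1 - b * u) * (1 - b * v) * integralSum q a b c d u v
      = (1 - a * b * u * v) * (1 - b * c * u * v) * integralSum q a (b * q) c d u v := by
  have e₁ := halfSum_step hq hu hv (.inl rfl) hz h₁
  have e₂ := halfSum_step hq hu hv (.inr rfl) hz h₂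
  simp only [integralSum]
  linear_combination e₂ - e₁

theorem integralSum_iterate (hq : ‖q‖ < 1) (hu : u ≠ 0) (hv : v ≠ 0)
    (hz : ‖b * d * u * v‖ < 1)
    (h₁ : RegularAt q a b c d u v u) (h₂ : RegularAt q a b c d u v v) (n : ℕ) :
    qPoch (b * u) q n * qPoch (b * v) q n * integralSum q a b c d u v
      = qPoch (a * b * u * v) q n * qPoch (b * c * u * v) q n
        * integralSum q a (b * q ^ n) c d u v := by
  induction n with
  | zero => simp
  | succ n ih =>
    have := integralSum_step hq hu hv (norm_shift_lt_one hq hz n) (h₁.mul_pow_right n)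
      (h₂.mul_pow_right n)
    rw [show b * q ^ n * q = b * q ^ (n + 1) by ring] at this
    simp only [qPoch_succ]
    linear_combination (1 - b * u * q ^ n) * (1 - b * v * q ^ n) * ih
      + qPoch (a * b * u * v) q n * qPoch (b * c * u * v) q n * this

theorem tendsto_halfSum (hq : ‖q‖ < 1) (hz : ‖b * d * u * v‖ < 1)
    (h : RegularAt q a b c d u v w) :
    Tendsto (fun m : ℕ => halfSum q a (b * q ^ m) c d u v w) atTop
      (𝓝 (halfSum q a 0 c d u v w)) := by
  obtain ⟨M, hM⟩ := exists_norm_integrand_le hq hz h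
  refine tendsto_tsum_of_dominated_convergence
    ((summable_geometric_of_lt_one (norm_nonneg q) hq).mul_left (‖w‖ * M)) (fun n => ?_)
    (Eventually.of_forall fun m n => ?_)
  · exact ((tendsto_integrand hq hz (h.mul_pow n)).const_mul w).mul_const _
  · rw [norm_mul, norm_mul, norm_pow]
    have := hM m n
    gcongr

theorem integralSum_eq (hq : ‖q‖ < 1) (hu : u ≠ 0) (hv : v ≠ 0) (hz : ‖b * d * u * v‖ < 1)
    (h₁ : RegularAt q a b c d u v u) (h₂ : RegularAt q a b c d u v v) :
    qPochInf (b * u) q * qPochInf (b * v) q * integralSum q a b c d u v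
      = qPochInf (a * b * u * v) q * qPochInf (b * c * u * v) q
        * integralSum q a 0 c d u v := by
  have l := ((tendsto_qPoch (b * u) hq).mul (tendsto_qPoch (b * v) hq)).mul_const
    (integralSum q a b c d u v)
  have r := ((tendsto_qPoch (a * b * u * v) hq).mul (tendsto_qPoch (b * c * u * v) hq)).mul
    ((tendsto_halfSum hq hz h₂).sub (tendsto_halfSum hq hz h₁))
  refine tendsto_nhds_unique l (r.congr fun n => ?_)
  exact (integralSum_iterate hq hu hv hz h₁ h₂ n).symm

end Shifts

/-! ### Moving parameters into the place of b, and the parameter-free integral -/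

/-- At b = 0 the argument bduv vanishes and the series is 1, so (acduvx; q)_∞ can serve as the
factor (abcuvx; q)_∞ with d in place of b. -/
theorem integrand_zero_comm (q a c d u v x : ℂ) :
    integrand q a 0 c d u v x = integrand q a d c 0 u v x := by
  simp only [integrand, phiFactor, mul_zero, zero_mul, phi_zero_arg, qPochInf_zero_left,
    inv_one, mul_one]
  rw [show a * d * c * u * v * x = a * c * d * u * v * x by ring]
  ring

theorem integrand_zero_zero_comm (q a c u v x : ℂ) :
    integrand q a 0 c 0 u v x = integrand q a c 0 0 u v x := by
  simp only [integrand, phiFactor, mul_zero, zero_mul, phi_zero_arg, qPochInf_zero_left,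
    inv_one, mul_one]

theorem integrand_single_comm (q a u v x : ℂ) :
    integrand q a 0 0 0 u v x = integrand q 0 a 0 0 u v x := by
  simp only [integrand, phiFactor, mul_zero, zero_mul, phi_zero_arg, qPochInf_zero_left,
    inv_one, mul_one]

/-- With b = q/u the integrand is (qx/v; q)_∞, and x (qx/v; q)_∞ = v [(qx/v; q)_∞ - (x/v; q)_∞]
telescopes along x = wqⁿ. -/
theorem halfSum_theta {q u v w : ℂ} (hq : ‖q‖ < 1) (hv : v ≠ 0)
    (hw : ∀ n : ℕ, q / u * w * q ^ n ≠ 1) :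
    halfSum q 0 (q / u) 0 0 u v w = v * (1 - qPochInf (w / v) q) := by
  have hr : RegularAt q 0 (q / u) 0 0 u v w := by
    constructor <;> simp [hw]
  have s := (summable_integrand hq (by simp) hr).hasSum
  have e (n : ℕ) : w * integrand q 0 (q / u) 0 0 u v (w * q ^ n) * q ^ n
      = v * (qPochInf (w / v * q ^ (n + 1)) q - qPochInf (w / v * q ^ n) q) := by
    have hn := qPochInf_ne_zero hq (hr.mul_pow n).hb
    have e₁ : q * (w * q ^ n) / v = w / v * q ^ n * q := by ring
    have e₂ : q * (w * q ^ n) / u = q / u * (w * q ^ n) := by ring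
    have e₃ : w / v * q ^ (n + 1) = w / v * q ^ n * q := by ring
    simp only [integrand, phiFactor, mul_zero, zero_mul, phi_zero_arg, qPochInf_zero_left,
      inv_one, mul_one, e₁, e₂, e₃]
    rw [qPochInf_eq_mul (w / v * q ^ n) hq]
    generalize qPochInf (q / u * (w * q ^ n)) q = X at *
    generalize qPochInf (w / v * q ^ n * q) q = Y
    field_simp
    ring
  simp only [e] at s
  have lim := s.tendsto_sum_nat
  simp only [← Finset.mul_sum] at lim
  have tel (n : ℕ) := Finset.sum_range_sub (fun k => qPochInf (w / v * q ^ k) q) n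
  simp only [tel, pow_zero, mul_one] at lim
  rw [halfSum]
  simp only [e]
  exact tendsto_nhds_unique lim
    (((tendsto_qPochInf_mul_pow (w / v) hq).sub_const _).const_mul v)

/-- The choice b = q/u requires (qv/u; q)_∞ ≠ 0, which |v| ≤ |u| ensures. The remaining case follows
by exchanging u and v, under which both sides change sign. -/
theorem integralSum_zero_of_norm_le {q u v : ℂ} (hq : ‖q‖ < 1) (hu : u ≠ 0) (hv : v ≠ 0)
    (huv : ‖v‖ ≤ ‖u‖) : integralSum q 0 0 0 0 u v = thetaDelta q u v := by
  have h₁ (n : ℕ) : q / u * u * q ^ n ≠ 1 := by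
    rw [div_mul_cancel₀ q hu]
    exact mul_pow_self_ne_one hq n
  have h₂ (n : ℕ) : q / u * v * q ^ n ≠ 1 := by
    refine mul_pow_ne_one hq ?_ n
    rw [div_mul_eq_mul_div, mul_div_assoc, norm_mul, norm_div]
    exact mul_lt_one_of_nonneg_of_lt_one_left (norm_nonneg _) hq
      (div_le_one_of_le₀ huv (norm_nonneg _))
  have r {w : ℂ} (hw : ∀ n : ℕ, q / u * w * q ^ n ≠ 1) : RegularAt q 0 (q / u) 0 0 u v w := by
    constructor <;> simp [hw]
  have key := integralSum_eq hq hu hv (by simp) (r h₁) (r h₂)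
  rw [integralSum, halfSum_theta hq hv h₁, halfSum_theta hq hv h₂, div_self hv,
    qPochInf_one hq, div_mul_cancel₀ q hu, div_mul_eq_mul_div] at key
  simp only [mul_zero, zero_mul, qPochInf_zero_left, one_mul] at key
  rw [← key]
  simp only [thetaDelta, qPochsInf, List.map_cons, List.map_nil, List.prod_cons, List.prod_nil]
  ring

theorem thetaDelta_antisymm {q u v : ℂ} (hq : ‖q‖ < 1) (hu : u ≠ 0) (hv : v ≠ 0) :
    thetaDelta q u v = -thetaDelta q v u := by
  simp only [thetaDelta, qPochsInf, List.map_cons, List.map_nil, List.prod_cons, List.prod_nil]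
  rw [qPochInf_eq_mul (u / v) hq, qPochInf_eq_mul (v / u) hq,
    show q * v / u = v / u * q by ring, show q * u / v = u / v * q by ring]
  field_simp
  ring

theorem halfSum_zero_comm (q u v w : ℂ) : halfSum q 0 0 0 0 u v w = halfSum q 0 0 0 0 v u w := by
  simp only [halfSum, integrand, phiFactor, mul_zero, zero_mul, phi_zero_arg]
  refine tsum_congr fun n => ?_
  ring

theorem integralSum_zero {q u v : ℂ} (hq : ‖q‖ < 1) (hu : u ≠ 0) (hv : v ≠ 0) :
    integralSum q 0 0 0 0 u v = thetaDelta q u v := by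
  rcases le_total ‖v‖ ‖u‖ with h | h
  · exact integralSum_zero_of_norm_le hq hu hv h
  · rw [thetaDelta_antisymm hq hu hv, ← integralSum_zero_of_norm_le hq hv hu h, integralSum,
      integralSum, halfSum_zero_comm q u v u, halfSum_zero_comm q u v v]
    ring

/-- Four uses of `integralSum_eq` remove b, d, c, a in turn, with factors (abuv, bcuv), (aduv,
cduv), (acuv) and 1. -/
theorem integralSum_mul_eq {q a b c d u v : ℂ} (hq : ‖q‖ < 1) (hu : u ≠ 0) (hv : v ≠ 0)
    (hz : ‖b * d * u * v‖ < 1)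
    (h₁ : RegularAt q a b c d u v u) (h₂ : RegularAt q a b c d u v v) :
    qPochInf (a * u) q * qPochInf (a * v) q * (qPochInf (b * u) q * qPochInf (b * v) q)
        * (qPochInf (c * u) q * qPochInf (c * v) q) * (qPochInf (d * u) q * qPochInf (d * v) q)
        * integralSum q a b c d u v
      = thetaDelta q u v * (qPochInf (a * b * u * v) q * qPochInf (a * c * u * v) q
        * qPochInf (a * d * u * v) q * qPochInf (b * c * u * v) q
        * qPochInf (c * d * u * v) q) := by
  have r₁ {w : ℂ} (h : RegularAt q a b c d u v w) : RegularAt q a d c 0 u v w :=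
    ⟨h.ha, h.hd, h.hc, by simp, fun n => by
      rw [show a * d * c * u * v * w = a * c * d * u * v * w by ring]
      exact h.hL n, by simp⟩
  have r₂ {w : ℂ} (h : RegularAt q a b c d u v w) : RegularAt q a c 0 0 u v w :=
    ⟨h.ha, h.hc, by simp, by simp, by simp, by simp⟩
  have r₃ {w : ℂ} (h : RegularAt q a b c d u v w) : RegularAt q 0 a 0 0 u v w :=
    ⟨by simp, h.ha, by simp, by simp, by simp, by simp⟩
  have e₁ := integralSum_eq hq hu hv hz h₁ h₂
  have e₂ := integralSum_eq hq hu hv (by simp) (r₁ h₁) (r₁ h₂)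
  have e₃ := integralSum_eq hq hu hv (by simp) (r₂ h₁) (r₂ h₂)
  have e₄ := integralSum_eq hq hu hv (by simp) (r₃ h₁) (r₃ h₂)
  have s₁ : integralSum q a 0 c d u v = integralSum q a d c 0 u v := by
    simp only [integralSum, halfSum, integrand_zero_comm q a c d]
  have s₂ : integralSum q a 0 c 0 u v = integralSum q a c 0 0 u v := by
    simp only [integralSum, halfSum, integrand_zero_zero_comm q a c]
  have s₃ : integralSum q a 0 0 0 u v = integralSum q 0 a 0 0 u v := by
    simp only [integralSum, halfSum, integrand_single_comm q a]
  rw [s₁] at e₁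
  rw [s₂] at e₂
  rw [s₃] at e₃
  rw [integralSum_zero hq hu hv] at e₄
  simp only [mul_zero, zero_mul, qPochInf_zero_left, one_mul, mul_one, mul_comm d c] at e₂ e₃ e₄
  linear_combination qPochInf (a * u) q * qPochInf (a * v) q
      * (qPochInf (c * u) q * qPochInf (c * v) q) * (qPochInf (d * u) q * qPochInf (d * v) q) * e₁
    + qPochInf (a * b * u * v) q * qPochInf (b * c * u * v) q
      * (qPochInf (a * u) q * qPochInf (a * v) q
        * (qPochInf (c * u) q * qPochInf (c * v) q) * e₂
        + qPochInf (a * d * u * v) q * qPochInf (c * d * u * v) q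
          * (qPochInf (a * u) q * qPochInf (a * v) q * e₃ + qPochInf (a * c * u * v) q * e₄))

end QSeries

/-! ### The integral formula -/

theorem mainTheorem5 (q a b c d u v : ℂ) (hq : ‖q‖ < 1) (hu : u ≠ 0) (hv : v ≠ 0)
    (hau : ‖a * u‖ < 1) (hbu : ‖b * u‖ < 1) (hcu : ‖c * u‖ < 1)
    (hav : ‖a * v‖ < 1) (hbv : ‖b * v‖ < 1) (hcv : ‖c * v‖ < 1)
    -- the argument of the series lies in its disc of convergence
    (hz : ‖b * d * u * v‖ < 1)
    -- no zero denominators: `(dx; q)_∞` and `(acduvx; q)_n` at `x = u q^m` and `x = v q^m`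
    (hdu : ∀ n : ℕ, d * u * q ^ n ≠ 1) (hdv : ∀ n : ℕ, d * v * q ^ n ≠ 1)
    (hlu : ∀ n : ℕ, a * c * d * u * v * u * q ^ n ≠ 1)
    (hlv : ∀ n : ℕ, a * c * d * u * v * v * q ^ n ≠ 1) :
    (∀ m : ℕ, ∀ x : ℂ, x = u * q ^ m ∨ x = v * q ^ m →
      Summable (QSeries.phiTerm [a * c * u * v, a * x, c * x]
        [a * b * c * u * v * x, a * c * d * u * v * x] q (b * d * u * v))) ∧
    QSeries.HasQIntegral q u v
      (fun x =>
        QSeries.qPochsInf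
            [q * x / u, q * x / v, a * b * c * u * v * x, a * c * d * u * v * x] q
          / QSeries.qPochsInf [a * x, b * x, c * x, d * x] q
          * QSeries.phi [a * c * u * v, a * x, c * x]
              [a * b * c * u * v * x, a * c * d * u * v * x] q (b * d * u * v))
      ((1 - q) * QSeries.thetaDelta q u v
        * QSeries.qPochsInf
            [a * b * u * v, a * c * u * v, a * d * u * v, b * c * u * v, c * d * u * v] q
        / QSeries.qPochsInf
            [a * u, a * v, b * u, b * v, c * u, c * v, d * u, d * v] q) := by
  -- For the lower parameter abcuvx: at x = u it is (au)(bv)(cu), at x = v it is (av)(bu)(cv).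
  have norm_lt {x y z w : ℂ} (hx : ‖x‖ < 1) (hy : ‖y‖ < 1) (hz : ‖z‖ < 1) (e : w = x * y * z) :
      ‖w‖ < 1 := by
    rw [e, norm_mul, norm_mul]
    exact mul_lt_one_of_nonneg_of_lt_one_left (by positivity)
      (mul_lt_one_of_nonneg_of_lt_one_left (norm_nonneg _) hx hy.le) hz.le
  have h₁ : QSeries.RegularAt q a b c d u v u :=
    ⟨QSeries.mul_pow_ne_one hq hau, QSeries.mul_pow_ne_one hq hbu, QSeries.mul_pow_ne_one hq hcu,
      hdu, QSeries.mul_pow_ne_one hq (norm_lt hau hbv hcu (by ring)), hlu⟩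
  have h₂ : QSeries.RegularAt q a b c d u v v :=
    ⟨QSeries.mul_pow_ne_one hq hav, QSeries.mul_pow_ne_one hq hbv, QSeries.mul_pow_ne_one hq hcv,
      hdv, QSeries.mul_pow_ne_one hq (norm_lt hav hbu hcv (by ring)), hlv⟩
  refine ⟨fun m x hx => ?_, ?_⟩
  · have hr : QSeries.RegularAt q a b c d u v x := by
      rcases hx with rfl | rfl
      exacts [h₁.mul_pow m, h₂.mul_pow m]
    exact QSeries.summable_phiTerm hq _ _ _ hr.hB hr.hL hz
  -- This holds at every x, even where a denominator vanishes, since inversion is multiplicative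
  -- with 0⁻¹ = 0.
  · have hf : (fun x => QSeries.qPochsInf
            [q * x / u, q * x / v, a * b * c * u * v * x, a * c * d * u * v * x] q
          / QSeries.qPochsInf [a * x, b * x, c * x, d * x] q
          * QSeries.phi [a * c * u * v, a * x, c * x]
              [a * b * c * u * v * x, a * c * d * u * v * x] q (b * d * u * v))
        = QSeries.integrand q a b c d u v := by
      funext x
      simp only [QSeries.qPochsInf, QSeries.integrand, QSeries.phiFactor, List.map_cons,
        List.map_nil, List.prod_cons, List.prod_nil, div_eq_mul_inv, mul_inv, inv_one]
      ring
    have s₁ := QSeries.summable_integrand hq hz h₁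
    have s₂ := QSeries.summable_integrand hq hz h₂
    have e (n : ℕ) : (v * QSeries.integrand q a b c d u v (v * q ^ n)
          - u * QSeries.integrand q a b c d u v (u * q ^ n)) * q ^ n
        = v * QSeries.integrand q a b c d u v (v * q ^ n) * q ^ n
          - u * QSeries.integrand q a b c d u v (u * q ^ n) * q ^ n := sub_mul _ _ _
    rw [hf]
    refine ⟨?_, ?_⟩
    · simpa only [QSeries.QIntegrable, e] using s₂.sub s₁
    · have key := QSeries.integralSum_mul_eq hq hu hv hz h₁ h₂
      simp only [QSeries.qIntegral, e]
      rw [s₂.tsum_sub s₁]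
      change (1 - q) * QSeries.integralSum q a b c d u v = _
      have ne {z w : ℂ} (h : ∀ n : ℕ, z * w * q ^ n ≠ 1) := QSeries.qPochInf_ne_zero hq h
      have n₁ := ne h₁.ha
      have n₂ := ne h₁.hb
      have n₃ := ne h₁.hc
      have n₄ := ne h₁.hd
      have n₅ := ne h₂.ha
      have n₆ := ne h₂.hb
      have n₇ := ne h₂.hc
      have n₈ := ne h₂.hd
      rw [eq_div_iff (by simp [QSeries.qPochsInf, *])]
      simp only [QSeries.qPochsInf, List.map_cons, List.map_nil, List.prod_cons, List.prod_nil]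
      linear_combination (1 - q) * key
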